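/- Let $\mathcal H$ be a separable infinite-dimensional complex Hilbert space and let $a\in\mathcal B(\mathcal H)$ be a normal operator with spectrum $\operatorname{spec}(a)$. Let $p_a$ be the orthogonal projection onto the closure of the range of $a$, put $$\mathcal V_a=\{v\in\mathcal B(\mathcal H)\mid v^*v=p_a\},\qquad \mathcal O_a=\{vav^*\mid v\in\mathcal V_a\},$$ and let $\alpha_a\colon\mathcal V_a\to\mathcal O_a$, $\alpha_a(v)=vav^*$. Let $\tau_{\|\cdot\|}$ be the topology that $\mathcal O_a$ inherits from the operator norm topology of $\mathcal B(\mathcal H)$, and let $\tau_q$ be the quotient topology on $\mathcal O_a$ for the map $\alpha_a$, where $\mathcal V_a$ carries the operator norm topology. ($\tau_q$ is the topology of the quotient manifold $\mathcal O_a\simeq\mathcal V_a/K_a$, where $K_a=\{w\in\mathcal V_a\mid waw^*=a\}$.) A subset $S$ of a real Banach space $X$ is called an embedded split submanifold if for every $x\in S$ there are a $C^\infty$-diffeomorphism $\chi\colon U\to V$ between open subsets of $X$ with $x\in U$, $\chi(x)=0$, and a closed complemented real linear subspace $F\subseteq X$, possibly depending on $x$, such that $\chi(U\cap S)=V\cap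 F$. 1. If $\mathcal O_a$ is norm-closed in $\mathcal B(\mathcal H)$ and $\tau_q=\tau_{\|\cdot\|}$, then $\operatorname{spec}(a)$ is finite, and $\mathcal O_a$ is a closed embedded split submanifold of $\mathcal B(\mathcal H)$. Its submanifold structure is that of the quotient manifold, that is, $\alpha_a\colon\mathcal V_a\to\mathcal O_a$ is a submersion: for every $v\in\mathcal V_a$ there are an open neighbourhood $U\subseteq\mathcal B(\mathcal H)$ of $vav^*$ and a $C^\infty$ map $\sigma\colon U\to\mathcal B(\mathcal H)$ with $\sigma(vav^*)=v$ and, for every $c\in U\cap\mathcal O_a$, $\sigma(c)\in\mathcal V_a$ and $\alpha_a(\sigma(c))=c$. 2. If $\operatorname{spec}(a)$ is infinite and has no accumulation point other than $0$, then $\tau_q$ is strictly finer than $\tau_{\|\cdot\|}$. -/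

import Mathlib

open scoped ContDiff

noncomputable section

namespace GroupoidOrbit

section Orbit

variable {H : Type*} [NormedAddCommGroup H] [InnerProductSpace ℂ H] [CompleteSpace H]

/-- The range projection `p_a`: the orthogonal projection of `H` onto the closure of the range
of `a`. -/
def rangeProj (a : H →L[ℂ] H) : H →L[ℂ] H :=
  (LinearMap.range (a : H →ₗ[ℂ] H)).topologicalClosure.starProjection

/-- The set `V_a = {v | v* v = p_a}` of the partial isometries with initial projection `p_a`.
As `p_a` is a projection, every such `v` is a partial isometry. -/
def initialIsometries (a : H →L[ℂ] H) : Set (H →L[ℂ] H) :=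
  {v | star v * v = rangeProj a}

/-- The groupoid orbit `O_a = {v a v* | v* v = p_a}`. -/
def orbit (a : H →L[ℂ] H) : Set (H →L[ℂ] H) :=
  {b | ∃ v ∈ initialIsometries a, b = v * a * star v}

/-- The orbit map `α_a : V_a → O_a`, `v ↦ v a v*`. -/
def orbitMap (a : H →L[ℂ] H) (v : initialIsometries a) : orbit a :=
  ⟨v.1 * a * star v.1, v.1, v.2, rfl⟩

/-- The topology `τ_q` of the quotient manifold `O_a ≃ V_a / K_a`: the quotient topology on `O_a`
for the orbit map `α_a`, where `V_a` carries the norm topology. -/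
abbrev quotientTopology (a : H →L[ℂ] H) : TopologicalSpace (orbit a) :=
  TopologicalSpace.coinduced (orbitMap a) instTopologicalSpaceSubtype

/-- The topology of `O_a` as a subspace of `B(H)` with the operator norm. -/
abbrev normTopology (a : H →L[ℂ] H) : TopologicalSpace (orbit a) :=
  instTopologicalSpaceSubtype

/-- The orbit map `α_a` has smooth local sections through every point `v` of `V_a`.
When `O_a` is an embedded split submanifold, this says that `α_a : V_a → O_a` is a submersion,
that is, that the submanifold structure of `O_a` is that of the quotient manifold `V_a / K_a`. -/
def HasSmoothLocalSections (a : H →L[ℂ] H) : Prop :=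
  ∀ v ∈ initialIsometries a, ∃ (U : Set (H →L[ℂ] H)) (σ : (H →L[ℂ] H) → (H →L[ℂ] H)),
    IsOpen U ∧ v * a * star v ∈ U ∧ ContDiffOn ℝ ∞ σ U ∧ σ (v * a * star v) = v ∧
      ∀ c ∈ U ∩ orbit a, σ c ∈ initialIsometries a ∧ σ c * a * star (σ c) = c

end Orbit

/-- `S` is an embedded split submanifold of the real normed space `X`: around every point of `S`
there is a smooth chart `χ` of `X` in which `S` is a closed complemented real linear subspace `F`.
The subspace `F` may depend on the point, so the connected components of `S` may be modelled on
different Banach spaces. -/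
def IsEmbeddedSplitSubmanifold {X : Type*} [NormedAddCommGroup X] [NormedSpace ℝ X]
    (S : Set X) : Prop :=
  ∀ x ∈ S, ∃ (F : Submodule ℝ X) (χ : OpenPartialHomeomorph X X),
    F.ClosedComplemented ∧ x ∈ χ.source ∧ χ x = 0 ∧
      ContDiffOn ℝ ∞ χ χ.source ∧ ContDiffOn ℝ ∞ χ.symm χ.target ∧
      ∀ y ∈ χ.source, y ∈ S ↔ χ y ∈ F

end GroupoidOrbit

end

noncomputable section

namespace GroupoidOrbit

/-! ### Range projections and the fibres of the orbit map -/

section RangeProjection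

variable {H : Type*} [NormedAddCommGroup H] [InnerProductSpace ℂ H] [CompleteSpace H]

/-! Everything depends on whether the spectrum is finite.

If it is infinite, it has an accumulation point `z` by compactness. Two spectral points near `z`
give orthonormal approximate eigenvectors, and exchanging these by a unitary `u` moves `a` only
slightly. Yet elements of the fibres over `a` and `u a u` are at distance at least 1, because
adjoints of elements in the fibre of `a` commute with the functional calculus of `a`
(`exists_orbit_near_fibre_far`). A sequence of such points converges to `a` in norm, but its set of
terms is closed in the quotient topology. Hence equality of the topologies forces a finite spectrum.

If it is finite, the spectral projections of `a` are polynomials `p i` in `a`, and `c ↦ ∑ p i (c) v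
p i (a)` is an analytic map which for `c` in the orbit intertwines `a` with `c`. Its polar part is a
local section of the orbit map (`exists_analytic_section`). Following it by the orbit map gives an
analytic retraction onto the orbit, and the image of such a retraction is a split submanifold
(`isEmbeddedSplitSubmanifold_of_retraction`). -/

theorem star_rangeProj (a : H →L[ℂ] H) : star (rangeProj a) = rangeProj a :=
  (isSelfAdjoint_starProjection _).star_eq

theorem rangeProj_mul_self (a : H →L[ℂ] H) : rangeProj a * rangeProj a = rangeProj a :=
  Submodule.isIdempotentElem_starProjection _

theorem rangeProj_mul (a : H →L[ℂ] H) : rangeProj a * a = a := by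
  ext x
  exact Submodule.starProjection_eq_self_iff.2
    (Submodule.le_topologicalClosure _ (LinearMap.mem_range_self _ x))

theorem mul_rangeProj_of_mul {a q : H →L[ℂ] H} (h : q * a = a) : q * rangeProj a = rangeProj a := by
  ext x
  have hcl : IsClosed {y : H | q y = y} := isClosed_eq q.continuous continuous_id
  have hsub : ((LinearMap.range (a : H →ₗ[ℂ] H)).topologicalClosure : Set H) ⊆ {y | q y = y} := by
    rw [Submodule.topologicalClosure_coe]
    refine closure_minimal ?_ hcl
    rintro _ ⟨y, rfl⟩
    exact DFunLike.congr_fun h y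
  exact hsub (Submodule.starProjection_apply_mem _ x)

/-- Normality gives `ker a* ⊆ ker a`, so the range of `a*` lies in the closure of the range of `a`;
the claim is the adjoint of this. -/
theorem mul_rangeProj {a : H →L[ℂ] H} (ha : IsStarNormal a) : a * rangeProj a = a := by
  have h : rangeProj a * star a = star a := by
    ext x
    refine Submodule.starProjection_eq_self_iff.2 ?_
    rw [← Submodule.orthogonal_orthogonal_eq_closure]
    intro y hy
    have h0 : (star a) y = 0 := by
      rw [← inner_self_eq_zero (𝕜 := ℂ), ContinuousLinearMap.star_eq_adjoint,
        ContinuousLinearMap.adjoint_inner_right]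
      exact (Submodule.mem_orthogonal _ _).1 hy _ (LinearMap.mem_range_self _ _)
    have h1 : a y = 0 := by
      rw [← inner_self_eq_zero (𝕜 := ℂ), ← ContinuousLinearMap.adjoint_inner_right,
        ← ContinuousLinearMap.star_eq_adjoint, ← mul_apply_eq_comp,
        ha.star_comm_self.eq, mul_apply_eq_comp, h0, map_zero, inner_zero_right]
    rw [ContinuousLinearMap.coe_coe, ContinuousLinearMap.star_eq_adjoint,
      ContinuousLinearMap.adjoint_inner_right, h1, inner_zero_left]
  simpa [star_rangeProj] using congrArg star h

theorem mul_rangeProj_of_mem {a v : H →L[ℂ] H} (hv : v ∈ initialIsometries a) :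
    v * rangeProj a = v := by
  have hv' : star v * v = rangeProj a := hv
  rw [← sub_eq_zero, ← CStarRing.star_mul_self_eq_zero_iff]
  simp only [star_sub, star_mul, star_rangeProj, sub_mul, mul_sub]
  simp only [mul_assoc, hv', rangeProj_mul_self]
  simp only [← mul_assoc, hv', rangeProj_mul_self]
  simp

theorem rangeProj_mul_star_of_mem {a v : H →L[ℂ] H} (hv : v ∈ initialIsometries a) :
    rangeProj a * star v = star v := by
  simpa [star_rangeProj] using congrArg star (mul_rangeProj_of_mem hv)

theorem rangeProj_mem (a : H →L[ℂ] H) : rangeProj a ∈ initialIsometries a := by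
  simp [initialIsometries, star_rangeProj, rangeProj_mul_self]

theorem rangeProj_conj {a : H →L[ℂ] H} (ha : IsStarNormal a) :
    rangeProj a * a * star (rangeProj a) = a := by
  rw [star_rangeProj, rangeProj_mul, mul_rangeProj ha]

theorem self_mem_orbit {a : H →L[ℂ] H} (ha : IsStarNormal a) : a ∈ orbit a :=
  ⟨_, rangeProj_mem a, (rangeProj_conj ha).symm⟩

/-- If `v ∈ V_a` fixes `a`, then `v*` commutes with `a`. -/
theorem commute_star_of_conj_eq {a v : H →L[ℂ] H}
    (hv : v ∈ initialIsometries a) (h : v * a * star v = a) : Commute a (star v) := by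
  have hv' : star v * v = rangeProj a := hv
  change a * star v = star v * a
  conv_rhs => rw [← h]
  rw [← mul_assoc, ← mul_assoc, hv', rangeProj_mul]

/-- Commuting with both `a` and `a*` puts `v*` in the commutant of the whole continuous functional
calculus of `a`. -/
theorem commute_star_star_of_conj_eq {a v : H →L[ℂ] H} (ha : IsStarNormal a)
    (hv : v ∈ initialIsometries a) (h : v * a * star v = a) : Commute (star a) (star v) := by
  have hv' : star v * v = rangeProj a := hv
  have h' : v * star a * star v = star a := by simpa [mul_assoc] using congrArg star h
  have h2 : rangeProj a * star a = star a := by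
    simpa [star_rangeProj] using congrArg star (mul_rangeProj ha)
  change star a * star v = star v * star a
  conv_rhs => rw [← h']
  rw [← mul_assoc, ← mul_assoc, hv', h2]

end RangeProjection

/-! ### Approximate eigenvectors from the functional calculus -/

section Tent

variable {H : Type*} [NormedAddCommGroup H] [InnerProductSpace ℂ H] [CompleteSpace H]

/-- The tent function of radius `r` around `z`. -/
def tent (z : ℂ) (r : ℝ) (x : ℂ) : ℂ := ((max 0 (r - ‖x - z‖) : ℝ) : ℂ)

theorem continuous_tent (z : ℂ) (r : ℝ) : Continuous (tent z r) := by
  unfold tent; fun_prop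

theorem star_tent_mul_tent {z w : ℂ} {r : ℝ} (h : 2 * r ≤ ‖z - w‖) (x : ℂ) :
    star (tent z r x) * tent w r x = 0 := by
  have : ‖z - w‖ ≤ ‖x - z‖ + ‖x - w‖ := by
    rw [← norm_neg (x - z)]
    calc ‖z - w‖ = ‖-(x - z) + (x - w)‖ := by congr 1; ring
      _ ≤ _ := norm_add_le _ _
  rcases le_total r ‖x - z‖ with h1 | h1
  · simp [tent, max_eq_left (sub_nonpos.2 h1)]
  · have h2 : r ≤ ‖x - w‖ := by linarith
    simp [tent, max_eq_left (sub_nonpos.2 h2)]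

/-- The vector is sought in the range of `a * S`: the factor `S` localizes it near `z`, and the
factor `a` puts it where partial isometries fixing `a` act isometrically. As `z ≠ 0`, the function
`x * tent z r x` does not vanish at `z`, so `a * S ≠ 0`. -/
theorem exists_unit_mul_tent {a : H →L[ℂ] H} (ha : IsStarNormal a) {z : ℂ}
    (hz : z ∈ spectrum ℂ a) (hz0 : z ≠ 0) {r : ℝ} (hr : 0 < r) :
    ∃ x, ‖a (cfc (tent z r) a x)‖ = 1 ∧
      ‖a (a (cfc (tent z r) a x)) - z • a (cfc (tent z r) a x)‖ ≤ 2 * r := by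
  set S := cfc (tent z r) a
  have hc := continuous_tent z r
  have haS : a * S = cfc (fun x => x * tent z r x) a := by
    rw [cfc_mul (fun x => x) (tent z r) a (by fun_prop) hc.continuousOn, cfc_id' ℂ a]
  have hne : a * S ≠ 0 := by
    intro h0
    have := norm_apply_le_norm_cfc (fun x => x * tent z r x) a hz
      (by fun_prop)
    rw [← haS, h0, norm_zero] at this
    have h1 : 0 < ‖z‖ * |r| := by positivity
    simp [tent, hr.le] at this
    linarith
  obtain ⟨y, hy⟩ : ∃ y, (a * S) y ≠ 0 := by
    by_contra! h
    exact hne (ContinuousLinearMap.ext h)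
  -- The cutoff is 1 on the support of the tent and 0 beyond radius `2 * r`, so `c` acts as `x - z`
  -- there while `‖c‖ ≤ 2 * r` everywhere.
  set c : ℂ → ℂ := fun x => (x - z) * ((max 0 (min 1 (2 - ‖x - z‖ / r)) : ℝ) : ℂ)
  have hcc : Continuous c := by fun_prop
  have hcn : ‖cfc c a‖ ≤ 2 * r := by
    refine norm_cfc_le (by positivity) fun x _ => ?_
    simp only [c, norm_mul, Complex.norm_real, Real.norm_eq_abs]
    rw [abs_of_nonneg (le_max_left _ _)]
    rcases le_total ‖x - z‖ (2 * r) with h | h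
    · calc _ ≤ ‖x - z‖ * 1 := by gcongr; simp
        _ ≤ _ := by simpa using h
    · have : 2 - ‖x - z‖ / r ≤ 0 := by
        rw [sub_nonpos, le_div_iff₀ hr]; exact h
      rw [max_eq_left ((min_le_right _ _).trans this)]
      simp [hr.le]
  have hcS : cfc c a * (a * S) = a * (a * S) - z • (a * S) := by
    have e1 : cfc c a * (a * S) = cfc (fun x => c x * (x * tent z r x)) a := by
      rw [haS, cfc_mul c _ a hcc.continuousOn (by fun_prop)]
    have e2 : a * (a * S) - z • (a * S) =
        cfc (fun x => x * (x * tent z r x) - z • (x * tent z r x)) a := by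
      rw [cfc_sub _ _ a (by fun_prop) (by fun_prop), cfc_smul z _ a (by fun_prop), ← haS,
        cfc_mul _ _ a (by fun_prop) (by fun_prop), ← haS, cfc_id' ℂ a]
    rw [e1, e2]
    congr 1
    funext x
    simp only [c, tent, smul_eq_mul]
    rcases le_total r ‖x - z‖ with h | h
    · simp [max_eq_left (sub_nonpos.2 h)]
    · have : 1 ≤ 2 - ‖x - z‖ / r := by
        have : ‖x - z‖ / r ≤ 1 := by rw [div_le_one hr]; exact h
        linarith
      rw [min_eq_left this]
      simp only [zero_le_one, max_eq_right, Complex.ofReal_one]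
      ring
  have hy' : ‖(a * S) y‖ ≠ 0 := norm_ne_zero_iff.2 hy
  have h1 : ‖a (S ((‖(a * S) y‖⁻¹ : ℂ) • y))‖ = 1 := by
    rw [map_smul, map_smul, norm_smul, norm_inv, Complex.norm_real, norm_norm]
    exact inv_mul_cancel₀ hy'
  refine ⟨(‖(a * S) y‖⁻¹ : ℂ) • y, h1, ?_⟩
  set x := (‖(a * S) y‖⁻¹ : ℂ) • y
  have := DFunLike.congr_fun hcS x
  simp only [mul_apply_eq_comp, sub_apply,
    smul_apply] at this
  rw [← this]
  calc _ ≤ ‖cfc c a‖ * ‖a (S x)‖ := ContinuousLinearMap.le_opNorm _ _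
    _ ≤ 2 * r := by rw [h1, mul_one]; exact hcn

omit [CompleteSpace H] in
theorem exists_spectral_pair {a : H →L[ℂ] H} {z : ℂ}
    (hz : AccPt z (Filter.principal (spectrum ℂ a))) {ε : ℝ} (hε : 0 < ε) :
    ∃ z₁ ∈ spectrum ℂ a, ∃ z₂ ∈ spectrum ℂ a, z₁ ≠ 0 ∧ z₂ ≠ 0 ∧ z₁ ≠ z₂ ∧
      ‖z₁ - z‖ < ε ∧ ‖z₂ - z‖ < ε := by
  have hinf : (Metric.ball z ε ∩ spectrum ℂ a).Infinite :=
    Set.Infinite.of_accPt (hz.nhds_inter (Metric.ball_mem_nhds z hε))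
  obtain ⟨z₁, h₁, h₁'⟩ := (hinf.sdiff (Set.finite_singleton (0 : ℂ))).nonempty
  obtain ⟨z₂, h₂, h₂'⟩ := (hinf.sdiff (Set.toFinite {(0 : ℂ), z₁})).nonempty
  simp only [Set.mem_insert_iff, Set.mem_singleton_iff, not_or] at h₁' h₂'
  exact ⟨z₁, h₁.2, z₂, h₂.2, h₁', h₂'.1, fun h => h₂'.2 h.symm,
    by simpa [dist_eq_norm] using h₁.1, by simpa [dist_eq_norm] using h₂.1⟩

end Tent

/-! ### Exchanging two orthonormal vectors -/

section Swap

variable {H : Type*} [NormedAddCommGroup H] [InnerProductSpace ℂ H]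

/-- The operator `1 - d d*`, where `d = f - f'`. For orthonormal `f` and `f'` it is the
self-adjoint unitary that exchanges them. -/
def swap (f f' : H) : H →L[ℂ] H := 1 - InnerProductSpace.rankOne ℂ (f - f') (f - f')

theorem swap_apply (f f' x : H) : swap f f' x = x - inner ℂ (f - f') x • (f - f') := rfl

theorem inner_sub_left_of_orthonormal {f f' : H} (hf : ‖f‖ = 1) (hff' : inner ℂ f f' = 0) :
    inner ℂ (f - f') f = 1 := by
  have : inner ℂ f' f = 0 := by rw [← inner_conj_symm, hff', map_zero]
  rw [inner_sub_left, this, inner_self_eq_norm_sq_to_K, hf]; simp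

theorem swap_apply_left {f f' : H} (hf : ‖f‖ = 1) (hff' : inner ℂ f f' = 0) :
    swap f f' f = f' := by
  rw [swap_apply, inner_sub_left_of_orthonormal hf hff']; simp

theorem swap_mul_swap {f f' : H} (hf : ‖f‖ = 1) (hf' : ‖f'‖ = 1) (hff' : inner ℂ f f' = 0) :
    swap f f' * swap f f' = 1 := by
  have h2 : inner ℂ (f - f') (f - f') = 2 := by
    have h1 : inner ℂ (f - f') f' = -1 := by
      rw [inner_sub_left, hff', inner_self_eq_norm_sq_to_K, hf']; simp
    rw [inner_sub_right, inner_sub_left_of_orthonormal hf hff', h1]; norm_num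
  ext x
  rw [mul_apply_eq_comp, swap_apply, swap_apply]
  rw [inner_sub_right, inner_smul_right, h2, one_apply_eq_self]
  module

theorem norm_swap_le {f f' : H} (hf : ‖f‖ = 1) (hf' : ‖f'‖ = 1) : ‖swap f f'‖ ≤ 5 := by
  have hd : ‖f - f'‖ ≤ 2 := (norm_sub_le _ _).trans (by rw [hf, hf']; norm_num)
  calc ‖swap f f'‖ ≤ ‖(1 : H →L[ℂ] H)‖ + ‖f - f'‖ * ‖f - f'‖ := by
        rw [← InnerProductSpace.norm_rankOne (𝕜 := ℂ)]; exact norm_sub_le _ _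
    _ ≤ 1 + 2 * 2 := by
        gcongr
        exact ContinuousLinearMap.norm_id_le
    _ = 5 := by norm_num

variable [CompleteSpace H]

theorem star_swap (f f' : H) : star (swap f f') = swap f f' := by
  rw [swap, star_sub, star_one, ContinuousLinearMap.star_eq_adjoint,
    InnerProductSpace.adjoint_rankOne]

/-- With `N = a - z` and `D = d d*`, the difference is `(N D - D N) * swap f f'`. Both products have
rank at most one, and normality of `N` bounds `N* d` by the same `2 * ε` as `N d`. The constant is
`(4 + 4) * 5`. -/
theorem norm_swap_conj_sub_le {a : H →L[ℂ] H} (ha : IsStarNormal a) {f f' : H} (hf : ‖f‖ = 1)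
    (hf' : ‖f'‖ = 1) (hff' : inner ℂ f f' = 0) {z : ℂ} {ε : ℝ} (h : ‖a f - z • f‖ ≤ ε)
    (h' : ‖a f' - z • f'‖ ≤ ε) : ‖swap f f' * a * swap f f' - a‖ ≤ 40 * ε := by
  set N : H →L[ℂ] H := a - z • 1
  set d := f - f'
  set D : H →L[ℂ] H := InnerProductSpace.rankOne ℂ d d
  have hd : ‖d‖ ≤ 2 := (norm_sub_le _ _).trans (by rw [hf, hf']; norm_num)
  have hε : 0 ≤ ε := (norm_nonneg _).trans h
  have hN : IsStarNormal N := by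
    refine ⟨?_⟩
    have := ha.star_comm_self
    simp only [N, star_sub, star_smul, star_one]
    exact (this.sub_right ((Commute.one_right _).smul_right z)).sub_left
      (((Commute.one_left _).sub_right ((Commute.one_right _).smul_right z)).smul_left _)
  have hNd : ‖N d‖ ≤ 2 * ε := by
    have : N d = (a f - z • f) - (a f' - z • f') := by
      simp [N, d, smul_sub]; abel
    rw [this]
    exact (norm_sub_le _ _).trans (by linarith)
  have hNd' : ‖(star N) d‖ ≤ 2 * ε := by
    rw [ContinuousLinearMap.star_eq_adjoint,
      ← ContinuousLinearMap.isStarNormal_iff_norm_eq_adjoint.1 hN d]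
    exact hNd
  have e : swap f f' * a * swap f f' - a = (N * D - D * N) * swap f f' := by
    have h1 : swap f f' * a = a * swap f f' + (N * D - D * N) := by
      simp only [swap, N, sub_mul, mul_sub, smul_mul_assoc, mul_smul_comm, one_mul, mul_one]
      abel
    rw [h1, add_mul, mul_assoc, swap_mul_swap hf hf' hff']
    simp
  have e1 : ‖N * D‖ ≤ 4 * ε := by
    have : N * D = InnerProductSpace.rankOne ℂ (N d) d := by
      ext x; simp [D]
    rw [this, InnerProductSpace.norm_rankOne]
    calc _ ≤ (2 * ε) * 2 := by gcongr
      _ = _ := by ring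
  have e2 : ‖D * N‖ ≤ 4 * ε := by
    have : D * N = InnerProductSpace.rankOne ℂ d (star N d) := by
      ext x
      simp only [D, mul_apply_eq_comp, InnerProductSpace.rankOne_apply,
        ContinuousLinearMap.star_eq_adjoint, ContinuousLinearMap.adjoint_inner_left]
    rw [this, InnerProductSpace.norm_rankOne]
    calc _ ≤ 2 * (2 * ε) := by gcongr
      _ = _ := by ring
  rw [e]
  calc _ ≤ ‖N * D - D * N‖ * ‖swap f f'‖ := norm_mul_le _ _
    _ ≤ (4 * ε + 4 * ε) * 5 := by
        gcongr
        · exact (norm_sub_le _ _).trans (add_le_add e1 e2)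
        · exact norm_swap_le hf hf'
    _ = _ := by ring

end Swap

/-! ### Infinite spectrum: the two topologies differ -/

section InfiniteSpectrum


variable {H : Type*} [NormedAddCommGroup H] [InnerProductSpace ℂ H] [CompleteSpace H]

/-- Near `a` there are points of the orbit whose fibres under the orbit map stay away from the
fibre of `a`. -/
theorem exists_orbit_near_fibre_far {a : H →L[ℂ] H} (ha : IsStarNormal a) {z : ℂ}
    (hz : AccPt z (Filter.principal (spectrum ℂ a))) {ε : ℝ} (hε : 0 < ε) :
    ∃ b ∈ orbit a, ‖b - a‖ ≤ ε ∧ ∀ v ∈ initialIsometries a, ∀ w ∈ initialIsometries a,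
      v * a * star v = a → w * a * star w = b → 1 ≤ ‖w - v‖ := by
  -- The distance to `z` and the eigenvector error `2 * r` each cost at most `ε / 80`; the factor 40
  -- of `norm_swap_conj_sub_le` turns their sum into `ε`.
  obtain ⟨z₁, hz₁, z₂, hz₂, h₁, h₂, h₁₂, hd₁, hd₂⟩ :=
    exists_spectral_pair hz (ε := ε / 80) (by positivity)
  have hpos : 0 < ‖z₁ - z₂‖ := norm_pos_iff.2 (sub_ne_zero.2 h₁₂)
  set r := min (ε / 160) (‖z₁ - z₂‖ / 2)
  have hr : 0 < r := lt_min (by positivity) (by positivity)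
  have hrε : 2 * r ≤ ε / 80 := by have := min_le_left (ε / 160) (‖z₁ - z₂‖ / 2); linarith
  have hrd : 2 * r ≤ ‖z₁ - z₂‖ := by
    have := min_le_right (ε / 160) (‖z₁ - z₂‖ / 2); linarith
  obtain ⟨x, hx, hx'⟩ := exists_unit_mul_tent ha hz₁ h₁ hr
  obtain ⟨y, hy, hy'⟩ := exists_unit_mul_tent ha hz₂ h₂ hr
  set S := cfc (tent z₁ r) a
  set T := cfc (tent z₂ r) a
  have hST : star S * T = 0 := by
    rw [← cfc_star, ← cfc_mul _ _ a ((continuous_tent _ _).star).continuousOn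
      (continuous_tent _ _).continuousOn]
    simp only [star_tent_mul_tent hrd]
    exact cfc_const_zero ℂ a
  have hST' : ∀ x y, inner ℂ (S x) (T y) = 0 := fun x y => by
    rw [← ContinuousLinearMap.adjoint_inner_right, ← ContinuousLinearMap.star_eq_adjoint,
      ← mul_apply_eq_comp, hST]
    simp
  have haS : Commute a S := (Commute.refl a).cfc ha.star_comm_self _ |>.symm
  have haT : Commute a T := (Commute.refl a).cfc ha.star_comm_self _ |>.symm
  set f := a (S x)
  set f' := a (T y)
  have hfS : f = S (a x) := DFunLike.congr_fun haS.eq x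
  have hfT : f' = T (a y) := DFunLike.congr_fun haT.eq y
  have hff' : inner ℂ f f' = 0 := by rw [hfS, hfT]; exact hST' _ _
  have near : ∀ (g : H) (w : ℂ), ‖g‖ = 1 → ‖a g - w • g‖ ≤ 2 * r → ‖w - z‖ < ε / 80 →
      ‖a g - z • g‖ ≤ ε / 40 := fun g w hg hw hwz => by
    calc ‖a g - z • g‖ = ‖(a g - w • g) + (w - z) • g‖ := by congr 1; module
      _ ≤ ‖a g - w • g‖ + ‖(w - z) • g‖ := norm_add_le _ _
      _ ≤ ε / 80 + ε / 80 := by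
          rw [norm_smul, hg, mul_one]; exact add_le_add (hw.trans hrε) hwz.le
      _ = _ := by ring
  set u := swap f f'
  have hu : star u = u := star_swap f f'
  have huu : u * u = 1 := swap_mul_swap hx hy hff'
  refine ⟨u * a * u, ⟨u * rangeProj a, ?_, ?_⟩, ?_, ?_⟩
  · change star (u * rangeProj a) * (u * rangeProj a) = rangeProj a
    rw [star_mul, hu, star_rangeProj, mul_assoc, ← mul_assoc u, huu, one_mul, rangeProj_mul_self]
  · rw [star_mul, hu, star_rangeProj]
    simp only [mul_assoc]
    rw [← mul_assoc (rangeProj a) a, rangeProj_mul, ← mul_assoc a, mul_rangeProj ha]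
  · refine (norm_swap_conj_sub_le ha hx hy hff' (near f z₁ hx hx' hd₁)
      (near f' z₂ hy hy' hd₂)).trans ?_
    linarith
  · intro v hv w hw hva hwb
    -- If `w` lies over `u a u`, then `u w` lies over `a`, so its adjoint commutes with `S`.
    have hw' : u * w ∈ initialIsometries a := by
      change star (u * w) * (u * w) = rangeProj a
      rw [star_mul, hu, mul_assoc, ← mul_assoc u, huu, one_mul]
      exact hw
    have hwa : (u * w) * a * star (u * w) = a := by
      rw [star_mul, hu]
      calc u * w * a * (star w * u) = u * (w * a * star w) * u := by simp only [mul_assoc]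
        _ = (u * u) * a * (u * u) := by rw [hwb]; simp only [mul_assoc]
        _ = a := by rw [huu, one_mul, mul_one]
    have hwS : Commute S (star (u * w)) := (commute_star_of_conj_eq hw' hwa).cfc
      (commute_star_star_of_conj_eq ha hw' hwa) _
    have hvT : Commute T (star v) := (commute_star_of_conj_eq hv hva).cfc
      (commute_star_star_of_conj_eq ha hv hva) _
    -- Since `u f = f'`, `w* f' = (u w)* f` stays in the range of `S`, whereas `v* f'` stays in the
    -- range of `T`; these ranges are orthogonal.
    have hA : star w f' = S (star (u * w) (a x)) := by
      rw [← mul_apply_eq_comp S, hwS.eq, mul_apply_eq_comp, ← hfS, star_mul, hu,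
        mul_apply_eq_comp, swap_apply_left hx hff']
    have hB : star v f' = T (star v (a y)) := by
      rw [← mul_apply_eq_comp T, hvT.eq, mul_apply_eq_comp, ← hfT]
    have horth : inner ℂ (star w f') (star v f') = 0 := by rw [hA, hB]; exact hST' _ _
    have hvv : (v * star v) f' = f' := by
      have : v * star v * a = a := by
        rw [mul_assoc, ← (commute_star_of_conj_eq hv hva).eq, ← mul_assoc, hva]
      exact DFunLike.congr_fun this (T y)
    have hn : ‖star v f'‖ = 1 := by
      have h1 : ‖star v f'‖ ^ 2 = 1 := by
        rw [ContinuousLinearMap.star_eq_adjoint, ContinuousLinearMap.apply_norm_sq_eq_inner_adjoint_left,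
          ContinuousLinearMap.adjoint_adjoint, ← ContinuousLinearMap.star_eq_adjoint]
        change RCLike.re (inner ℂ ((v * star v) f') f') = 1
        rw [hvv, inner_self_eq_norm_sq, hy]; norm_num
      exact (pow_eq_one_iff_of_nonneg (norm_nonneg _) two_ne_zero).1 h1
    have hpy := norm_sub_sq (𝕜 := ℂ) (star w f') (star v f')
    rw [horth, hn] at hpy
    have h1 : 1 ≤ ‖star w f' - star v f'‖ := by
      rw [map_zero] at hpy
      nlinarith [norm_nonneg (star w f' - star v f'), sq_nonneg ‖star w f'‖]
    calc 1 ≤ ‖star (w - v) f'‖ := by simpa using h1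
      _ ≤ ‖star (w - v)‖ * ‖f'‖ := ContinuousLinearMap.le_opNorm _ _
      _ = ‖w - v‖ := by rw [hy, mul_one, norm_star]

theorem continuous_orbitMap (a : H →L[ℂ] H) : Continuous (orbitMap a) := by
  unfold orbitMap
  fun_prop

theorem quotientTopology_le (a : H →L[ℂ] H) : quotientTopology a ≤ normTopology a :=
  continuous_iff_coinduced_le.1 (continuous_orbitMap a)

/-- The set of terms of a sequence `b k → a` from `exists_orbit_near_fibre_far` is not norm-closed.
Its preimage is closed: a limit point maps to `a` or to some `b k`, and `a` is excluded by the
distance 1 between fibres. -/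
theorem quotientTopology_ne_of_infinite_spectrum {a : H →L[ℂ] H} (ha : IsStarNormal a)
    (hs : (spectrum ℂ a).Infinite) : quotientTopology a ≠ normTopology a := by
  intro heq
  obtain ⟨z, -, hz⟩ :=
    hs.exists_accPt_of_subset_isCompact (spectrum.isCompact a) Set.Subset.rfl
  choose b hb hba hfar using fun k : ℕ =>
    exists_orbit_near_fibre_far ha hz (ε := 1 / ((k : ℝ) + 1)) (by positivity)
  have hlim : Filter.Tendsto b Filter.atTop (nhds a) := by
    rw [tendsto_iff_norm_sub_tendsto_zero]
    exact squeeze_zero (fun _ => norm_nonneg _) hba tendsto_one_div_add_atTop_nhds_zero_nat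
  have hne : ∀ k, b k ≠ a := fun k h => by
    have := hfar k _ (rangeProj_mem a) _ (rangeProj_mem a) (rangeProj_conj ha)
      ((rangeProj_conj ha).trans h.symm)
    norm_num at this
  set C : Set (orbit a) := {c | c.1 ∈ Set.range b}
  have hpre : IsClosed (orbitMap a ⁻¹' C) := by
    refine isClosed_of_closure_subset fun v hv => ?_
    have hmem : (orbitMap a v).1 ∈ insert a (Set.range b) := by
      have hcl : IsClosed {c : orbit a | c.1 ∈ insert a (Set.range b)} :=
        hlim.isCompact_insert_range.isClosed.preimage continuous_subtype_val
      have : closure (orbitMap a ⁻¹' C) ⊆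
          orbitMap a ⁻¹' {c : orbit a | c.1 ∈ insert a (Set.range b)} :=
        closure_minimal (fun w hw => Set.mem_insert_of_mem _ hw)
          (hcl.preimage (continuous_orbitMap a))
      exact this hv
    rcases hmem with h | h
    · obtain ⟨w, ⟨k, hk⟩, hw⟩ := Metric.mem_closure_iff.1 hv 1 one_pos
      have h1 := hfar k v.1 v.2 w.1 w.2 h hk.symm
      rw [dist_comm, Subtype.dist_eq, dist_eq_norm] at hw
      exact absurd h1 hw.not_ge
    · exact h
  have hq : @IsClosed _ (quotientTopology a) C := isClosed_coinduced.2 hpre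
  rw [heq] at hq
  have : (⟨a, self_mem_orbit ha⟩ : orbit a) ∈ C := by
    refine hq.mem_of_tendsto (b := Filter.atTop) (f := fun k => (⟨b k, hb k⟩ : orbit a)) ?_
      (Filter.Eventually.of_forall fun k => ⟨k, rfl⟩)
    exact tendsto_subtype_rng.2 hlim
  obtain ⟨k, hk⟩ := this
  exact hne k hk

end InfiniteSpectrum

/-! ### An analytic square root near 1 -/

section SquareRoot

open Filter Topology

/-- Here `2 d = -(d (y - 1) + (y - 1) d)` has norm at most `2 ‖d‖ ‖y - 1‖`. This lets a square root
near 1 inherit commutation and self-adjointness from its square. -/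
theorem eq_zero_of_mul_add_mul_eq_zero {A : Type*} [NormedRing A] [NormedAlgebra ℝ A] {d y : A}
    (h : d * y + y * d = 0) (hy : ‖y - 1‖ < 1) : d = 0 := by
  have e : (2 : ℝ) • d = -(d * (y - 1) + (y - 1) * d) := by
    have : d * (y - 1) + (y - 1) * d = (d * y + y * d) - (2 : ℝ) • d := by
      rw [two_smul]; noncomm_ring
    rw [this, h]; simp
  have h1 : 2 * ‖d‖ ≤ 2 * (‖d‖ * ‖y - 1‖) := by
    calc 2 * ‖d‖ = ‖(2 : ℝ) • d‖ := by rw [norm_smul]; norm_num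
      _ ≤ ‖d * (y - 1)‖ + ‖(y - 1) * d‖ := by rw [e, norm_neg]; exact norm_add_le _ _
      _ ≤ ‖d‖ * ‖y - 1‖ + ‖y - 1‖ * ‖d‖ := add_le_add (norm_mul_le _ _) (norm_mul_le _ _)
      _ = _ := by ring
  by_contra hd
  have : 0 < ‖d‖ := norm_pos_iff.2 hd
  nlinarith

theorem commute_of_commute_sq {A : Type*} [NormedRing A] [NormedAlgebra ℝ A] {s b : A}
    (h : Commute (s * s) b) (hs : ‖s - 1‖ < 1) : Commute s b := by
  have h' : s * s * b = b * (s * s) := h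
  refine sub_eq_zero.1 (eq_zero_of_mul_add_mul_eq_zero (y := s) ?_ hs)
  calc (s * b - b * s) * s + s * (s * b - b * s) = s * s * b - b * (s * s) := by noncomm_ring
    _ = 0 := sub_eq_zero.2 h'

theorem star_eq_of_star_sq {A : Type*} [NormedRing A] [StarRing A] [NormedStarGroup A]
    [NormedAlgebra ℝ A] {s : A}
    (h : star (s * s) = s * s) (hs : ‖s - 1‖ < 1) : star s = s := by
  have h' : star s * star s = s * s := by rw [← star_mul, h]
  refine sub_eq_zero.1
    (eq_zero_of_mul_add_mul_eq_zero (y := (2⁻¹ : ℝ) • (s + star s)) ?_ ?_)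
  · calc _ = star s * star s - s * s := by
          simp only [mul_smul_comm, smul_mul_assoc, ← smul_add]
          rw [inv_smul_eq_iff₀ two_ne_zero, two_smul]
          noncomm_ring
      _ = 0 := sub_eq_zero.2 h'
  · have hs' : ‖star s - 1‖ < 1 := by
      rw [← norm_star]; simpa using hs
    have : (2⁻¹ : ℝ) • (s + star s) - 1 = (2⁻¹ : ℝ) • ((s - 1) + (star s - 1)) := by module
    rw [this, norm_smul]
    have := norm_add_le (s - 1) (star s - 1)
    norm_num
    linarith

/-- The inverse function theorem applies to squaring, whose derivative at 1 is multiplication by 2.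
-/
theorem exists_analytic_sqrt (A : Type*) [NormedRing A] [NormedAlgebra ℝ A] [CompleteSpace A] :
    ∃ s : A → A, s 1 = 1 ∧ ContDiffAt ℝ ω s 1 ∧ ∀ᶠ x in 𝓝 1, s x * s x = x := by
  have hf : ContDiffAt ℝ ω (fun x : A => x * x) 1 := contDiffAt_id.mul contDiffAt_id
  let e : A ≃L[ℝ] A := ContinuousLinearEquiv.smulLeft (Units.mk0 (2 : ℝ) two_ne_zero)
  have hf' : HasFDerivAt (fun x : A => x * x) (e : A →L[ℝ] A) 1 := by
    have := (hasFDerivAt_id (𝕜 := ℝ) (1 : A)).mul' (hasFDerivAt_id (𝕜 := ℝ) (1 : A))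
    have he : (e : A →L[ℝ] A) = id (1 : A) • ContinuousLinearMap.id ℝ A +
        MulOpposite.op (id (1 : A)) • ContinuousLinearMap.id ℝ A := by
      ext x
      change (2 : ℝ) • x = (1 : A) * x + x * (1 : A)
      rw [one_mul, mul_one, two_smul]
    rw [he]
    exact this
  have hω : (ω : WithTop ℕ∞) ≠ 0 := by simp
  have h1 := hf.localInverse_apply_image hf' hω
  have h2 := hf.to_localInverse hf' hω
  have h3 := (hf.hasStrictFDerivAt' hf' hω).eventually_right_inverse
  simp only [mul_one] at h1 h2 h3
  exact ⟨hf.localInverse hf' hω, h1, h2, h3⟩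

end SquareRoot

/-! ### Polar part of an element with prescribed initial projection -/

section Polar

variable {A : Type*} [NormedRing A] [StarRing A] [NormedStarGroup A]
    [NormedAlgebra ℝ A] {T p s : A}
    (hp : star p = p) (hpp : p * p = p) (hT : T * p = T) (hX : IsUnit (star T * T + (1 - p)))
    (hs : s * s = Ring.inverse (star T * T + (1 - p))) (hs1 : ‖s - 1‖ < 1)
include hX hs hs1

omit [NormedStarGroup A] in
theorem polar_commute {b : A} (hb : Commute (star T * T) b) (hb' : Commute p b) : Commute s b := by
  refine commute_of_commute_sq ?_ hs1
  rw [hs]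
  have h := hb.add_left ((Commute.one_left b).sub_left hb')
  obtain ⟨u, hu⟩ := hX
  rw [← hu] at h ⊢
  rw [Ring.inverse_unit]
  exact h.units_inv_left

omit hX in
include hp in
theorem polar_star : star s = s := by
  refine star_eq_of_star_sq ?_ hs1
  rw [hs, ← Ring.inverse_star]
  congr 1
  simp [hp]

-- The summand `1 - p` lets `X = T* T + (1 - p)` be invertible although `T` vanishes on `1 - p`. As
-- `s` commutes with `X` and `p`, `s T* T s = s X s - s (1 - p) s = 1 - (1 - p)`.
include hp hpp hT in
theorem polar_star_mul_self : star (T * s) * (T * s) = p := by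
  have hpT : p * star T = star T := by simpa [hp] using congrArg star hT
  set X := star T * T + (1 - p) with hXd
  have hTT : star T * T = X - (1 - p) := by rw [hXd]; abel
  have hsX : Commute s X := by
    refine commute_of_commute_sq ?_ hs1
    rw [hs]; exact (Ring.inverse_mul_cancel _ hX).trans (Ring.mul_inverse_cancel _ hX).symm
  have hpc : Commute p (star T * T) := by
    change p * (star T * T) = star T * T * p
    rw [← mul_assoc, hpT, mul_assoc, hT]
  have hsp : Commute s p := polar_commute hX hs hs1 hpc.symm (Commute.refl p)
  have hqX : (1 - p) * X = 1 - p := by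
    rw [hXd, mul_add, sub_mul, sub_mul, one_mul, one_mul, ← mul_assoc, hpT, sub_self, zero_add,
      mul_sub, mul_one, hpp, sub_self, sub_zero]
  have hqX' : (1 - p) * Ring.inverse X = 1 - p := by
    conv_lhs => rw [← hqX, mul_assoc, Ring.mul_inverse_cancel _ hX, mul_one]
  have hsq : Commute s (1 - p) := (Commute.one_right s).sub_right hsp
  rw [star_mul, polar_star hp hs hs1]
  calc s * star T * (T * s) = s * (star T * T) * s := by simp only [mul_assoc]
    _ = s * X * s - s * (1 - p) * s := by rw [hTT]; noncomm_ring
    _ = X * (s * s) - (1 - p) * (s * s) := by rw [hsX.eq, hsq.eq]; simp only [mul_assoc]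
    _ = p := by rw [hs, Ring.mul_inverse_cancel _ hX, hqX']; abel

end Polar

/-! ### Spectral projections as polynomials -/

section Polynomial

open Polynomial

variable {H : Type*} [NormedAddCommGroup H] [InnerProductSpace ℂ H] [CompleteSpace H]

theorem aeval_congr_of_spectrum {a : H →L[ℂ] H} (ha : IsStarNormal a) {p q : ℂ[X]}
    (h : ∀ x ∈ spectrum ℂ a, p.eval x = q.eval x) : aeval a p = aeval a q := by
  rw [← cfc_polynomial p a, ← cfc_polynomial q a]
  exact cfc_congr h

theorem star_aeval_of_spectrum {a : H →L[ℂ] H} (ha : IsStarNormal a) {p : ℂ[X]}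
    (h : ∀ x ∈ spectrum ℂ a, star (p.eval x) = p.eval x) : star (aeval a p) = aeval a p := by
  rw [← cfc_polynomial p a, ← cfc_star]
  exact cfc_congr h

theorem rangeProj_mul_aeval (a : H →L[ℂ] H) {p : ℂ[X]} (hp : p.eval 0 = 0) :
    rangeProj a * aeval a p = aeval a p := by
  obtain ⟨q, rfl⟩ := X_dvd_iff.2 ((coeff_zero_eq_eval_zero _).trans hp)
  rw [map_mul, aeval_X, ← mul_assoc, rangeProj_mul]

/-- Lagrange polynomials serve here because they can also be evaluated, analytically, at operators
`c` near the orbit. -/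
theorem exists_spectral_polynomials {a : H →L[ℂ] H} (ha : IsStarNormal a)
    (hfin : (spectrum ℂ a).Finite) :
    ∃ (s : Finset ℂ) (p : ℂ → ℂ[X]), (∀ i ∈ s, (p i).eval 0 = 0) ∧
      (∀ i ∈ s, a * aeval a (p i) = i • aeval a (p i)) ∧
      (∀ i ∈ s, star (aeval a (p i)) = aeval a (p i)) ∧
      (∀ i ∈ s, aeval a (p i) * aeval a (p i) = aeval a (p i)) ∧
      ∑ i ∈ s, aeval a (p i) = rangeProj a := by
  classical
  -- The node 0 is added even when it is not in the spectrum, to make every `p i` with `i ≠ 0`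
  -- vanish at 0.
  set t : Finset ℂ := insert 0 hfin.toFinset with ht
  set p : ℂ → ℂ[X] := fun i => Lagrange.basis t id i
  have hst : ∀ x ∈ spectrum ℂ a, x ∈ t := fun x hx => by simp [ht, hx]
  have h0t : (0 : ℂ) ∈ t := Finset.mem_insert_self _ _
  have hinj : Set.InjOn (id : ℂ → ℂ) t := Function.injective_id.injOn
  have hev : ∀ i ∈ t, ∀ x ∈ t, (p i).eval x = if i = x then 1 else 0 := fun i hi x hx => by
    split_ifs with h
    · subst h; exact Lagrange.eval_basis_self (v := (id : ℂ → ℂ)) hinj hi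
    · exact Lagrange.eval_basis_of_ne (v := (id : ℂ → ℂ)) h hx
  set s := t.erase 0
  have hs : ∀ i ∈ s, i ∈ t ∧ i ≠ 0 := fun i hi => ⟨Finset.mem_of_mem_erase hi,
    Finset.ne_of_mem_erase hi⟩
  have hp0 : ∀ i ∈ s, (p i).eval 0 = 0 := fun i hi => by
    rw [hev i (hs i hi).1 0 h0t, if_neg (hs i hi).2]
  have hstar : ∀ i ∈ s, star (aeval a (p i)) = aeval a (p i) := fun i hi => by
    refine star_aeval_of_spectrum ha fun x hx => ?_
    rw [hev i (hs i hi).1 x (hst x hx)]; split_ifs <;> simp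
  refine ⟨s, p, hp0, fun i hi => ?_, hstar, fun i hi => ?_, ?_⟩
  · have : aeval a (X * p i) = aeval a (C i * p i) := by
      refine aeval_congr_of_spectrum ha fun x hx => ?_
      simp only [eval_mul, eval_X, eval_C]
      rw [hev i (hs i hi).1 x (hst x hx)]; split_ifs with h <;> simp [h]
    simpa [Algebra.smul_def] using this
  · rw [← map_mul]
    refine aeval_congr_of_spectrum ha fun x hx => ?_
    rw [eval_mul, hev i (hs i hi).1 x (hst x hx)]; split_ifs <;> simp
  · set e := ∑ i ∈ s, aeval a (p i)
    have hpe : rangeProj a * e = e := by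
      rw [Finset.mul_sum]
      exact Finset.sum_congr rfl fun i hi => rangeProj_mul_aeval a (hp0 i hi)
    have hse : star e = e := by
      rw [star_sum]; exact Finset.sum_congr rfl hstar
    have hea : e * a = a := by
      have : aeval a ((∑ i ∈ s, p i) * X) = aeval a (X : ℂ[X]) := by
        refine aeval_congr_of_spectrum ha fun x hx => ?_
        rw [eval_mul, eval_X, eval_finsetSum]
        rcases eq_or_ne x 0 with rfl | hx0
        · simp
        · have hxs : x ∈ s := Finset.mem_erase.2 ⟨hx0, hst x hx⟩
          rw [Finset.sum_congr rfl fun i hi => hev i (hs i hi).1 x (hst x hx)]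
          simp [hxs]
      simpa [e] using this
    have hep : e * rangeProj a = rangeProj a := mul_rangeProj_of_mul hea
    have hep' : rangeProj a * e = rangeProj a := by
      simpa [hse, star_rangeProj] using congrArg star hep
    rw [← hpe, hep']

theorem conj_mul_of_mem {a w : H →L[ℂ] H} (ha : IsStarNormal a) (hw : w ∈ initialIsometries a) :
    w * a * star w * w = w * a := by
  have hw' : star w * w = rangeProj a := hw
  rw [mul_assoc, hw', mul_assoc, mul_rangeProj ha]

theorem aeval_conj_mul {a w : H →L[ℂ] H} (ha : IsStarNormal a) (hw : w ∈ initialIsometries a)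
    (q : ℂ[X]) : aeval (w * a * star w) q * w = w * aeval a q := by
  have h := conj_mul_of_mem ha hw
  induction q using Polynomial.induction_on' with
  | add p q hp hq => rw [map_add, map_add, add_mul, mul_add, hp, hq]
  | monomial n c =>
    have : (w * a * star w) ^ n * w = w * a ^ n := by
      induction n with
      | zero => simp
      | succ n ih => rw [pow_succ, mul_assoc, h, ← mul_assoc, ih, mul_assoc, ← pow_succ]
    simp only [aeval_monomial, Algebra.algebraMap_eq_smul_one, smul_mul_assoc, one_mul, this,
      mul_smul_comm]

/-- A constant term would spoil the identity, since `w w*` need not be 1. -/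
theorem aeval_conj {a w : H →L[ℂ] H} (ha : IsStarNormal a) (hw : w ∈ initialIsometries a)
    {q : ℂ[X]} (hq : q.eval 0 = 0) :
    aeval (w * a * star w) q = w * aeval a q * star w := by
  obtain ⟨r, rfl⟩ := X_dvd_iff.2 ((coeff_zero_eq_eval_zero _).trans hq)
  rw [mul_comm, map_mul, aeval_X, map_mul, aeval_X]
  calc _ = (aeval (w * a * star w) r * w) * (a * star w) := by simp only [mul_assoc]
    _ = _ := by rw [aeval_conj_mul ha hw]; simp only [mul_assoc]

theorem contDiff_aeval_left (q : ℂ[X]) :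
    ContDiff ℝ ω (fun c : H →L[ℂ] H => aeval c q) := by
  simp only [aeval_eq_sum_range]
  exact ContDiff.sum fun i _ => (contDiff_id.pow i).const_smul _

end Polynomial

/-! ### Finite spectrum: analytic local sections -/

section LocalSection

open Polynomial Filter Topology

variable {H : Type*} [NormedAddCommGroup H] [InnerProductSpace ℂ H] [CompleteSpace H]

/-- If the spectrum of `a` is finite, then through every point of `V_a` there is an analytic map
with values in `V_a` that is a section of the orbit map on the orbit. -/
theorem exists_analytic_section {a : H →L[ℂ] H} (ha : IsStarNormal a)
    (hfin : (spectrum ℂ a).Finite) {v : H →L[ℂ] H} (hv : v ∈ initialIsometries a) :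
    ∃ σ : (H →L[ℂ] H) → (H →L[ℂ] H), ContDiffAt ℝ ω σ (v * a * star v) ∧
      σ (v * a * star v) = v ∧
      ∀ᶠ c in 𝓝 (v * a * star v), σ c ∈ initialIsometries a ∧
        (c ∈ orbit a → σ c * a * star (σ c) = c) := by
  obtain ⟨I, p, hp0, hap, hstar, hidem, hsum⟩ := exists_spectral_polynomials ha hfin
  obtain ⟨s, hs1, hsd, hss⟩ := exists_analytic_sqrt (H →L[ℂ] H)
  set P : ℂ → H →L[ℂ] H := fun i => aeval a (p i)
  set q := rangeProj a
  set b := v * a * star v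
  have hv' : star v * v = q := hv
  have hPq : ∀ i ∈ I, P i * q = P i := fun i hi => by
    have := rangeProj_mul_aeval a (hp0 i hi)
    simpa [q, P, star_rangeProj, hstar i hi] using congrArg star this
  have hqP : ∀ i ∈ I, q * P i = P i := fun i hi => rangeProj_mul_aeval a (hp0 i hi)
  set e : (H →L[ℂ] H) → (H →L[ℂ] H) := fun c => ∑ i ∈ I, aeval c (p i)
  -- Block by block, `T c` carries the spectral subspaces of `a` into those of `c`; at the base
  -- point it equals `v`.
  set T : (H →L[ℂ] H) → (H →L[ℂ] H) := fun c => ∑ i ∈ I, aeval c (p i) * v * P i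
  set X : (H →L[ℂ] H) → (H →L[ℂ] H) := fun c => star (T c) * T c + (1 - q)
  set S : (H →L[ℂ] H) → (H →L[ℂ] H) := fun c => s (Ring.inverse (X c))
  have hTq : ∀ c, T c * q = T c := fun c => by
    simp only [T, Finset.sum_mul]
    exact Finset.sum_congr rfl fun i hi => by rw [mul_assoc, hPq i hi]
  have heb : e b = v * star v := by
    calc e b = ∑ i ∈ I, v * P i * star v :=
          Finset.sum_congr rfl fun i hi => aeval_conj ha hv (hp0 i hi)
      _ = v * q * star v := by rw [← hsum, Finset.mul_sum, Finset.sum_mul]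
      _ = _ := by rw [mul_rangeProj_of_mem hv]
  have hTb : T b = v := by
    calc T b = ∑ i ∈ I, v * P i := Finset.sum_congr rfl fun i hi => by
          rw [aeval_conj_mul ha hv, mul_assoc, hidem i hi]
      _ = v * q := by rw [← hsum, Finset.mul_sum]
      _ = v := mul_rangeProj_of_mem hv
  have hXb : X b = 1 := by
    simp only [X, hTb, hv']; abel
  have hSb : S b = 1 := by simp only [S, hXb, Ring.inverse_one, hs1]
  have hTd : ContDiff ℝ ω T := ContDiff.sum fun i _ =>
    ((contDiff_aeval_left (p i)).mul contDiff_const).mul contDiff_const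
  have hXd : ContDiff ℝ ω X :=
    (((starL' ℝ : (H →L[ℂ] H) ≃L[ℝ] (H →L[ℂ] H)).contDiff.comp hTd).mul hTd).add contDiff_const
  have hid : ContDiffAt ℝ ω (fun c => Ring.inverse (X c)) b := by
    refine ContDiffAt.comp (g := Ring.inverse) b ?_ hXd.contDiffAt
    rw [hXb]
    exact contDiffAt_ringInverse ℝ (1 : (H →L[ℂ] H)ˣ)
  have hSd : ContDiffAt ℝ ω S b := by
    refine ContDiffAt.comp (g := s) b ?_ hid
    rw [hXb, Ring.inverse_one]
    exact hsd
  have hσd : ContDiffAt ℝ ω (fun c => T c * S c) b := hTd.contDiffAt.mul hSd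
  have hed : Continuous e := continuous_finsetSum _ fun i _ => (contDiff_aeval_left (p i)).continuous
  refine ⟨fun c => T c * S c, hσd,
    show T b * S b = v by rw [hTb, hSb, mul_one], ?_⟩
  have ev1 : ∀ᶠ c in 𝓝 b, IsUnit (X c) :=
    hXd.continuous.continuousAt.eventually (by rw [hXb]; exact Units.nhds 1)
  have ev2 : ∀ᶠ c in 𝓝 b, S c * S c = Ring.inverse (X c) := by
    refine hid.continuousAt.eventually (p := fun x => s x * s x = x) ?_
    change ∀ᶠ y in 𝓝 (Ring.inverse (X b)), s y * s y = y
    rw [hXb, Ring.inverse_one]; exact hss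
  have ev3 : ∀ᶠ c in 𝓝 b, ‖S c - 1‖ < 1 := by
    have : ContinuousAt (fun c => ‖S c - 1‖) b := (hSd.continuousAt.sub continuousAt_const).norm
    exact this.eventually_lt continuousAt_const (by simp [hSb])
  -- On the orbit, `e c` is the final projection of `w` and dominates that of `T c * S c`. Distance
  -- below 1 will force equality; at `b` both are `v v*`.
  have ev4 : ∀ᶠ c in 𝓝 b, ‖e c - T c * S c * star (T c * S c)‖ < 1 := by
    have : ContinuousAt (fun c => ‖e c - T c * S c * star (T c * S c)‖) b :=
      (hed.continuousAt.sub (hσd.continuousAt.mul hσd.continuousAt.star)).norm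
    refine this.eventually_lt continuousAt_const ?_
    simp [hTb, hSb, heb]
  filter_upwards [ev1, ev2, ev3, ev4] with c h1 h2 h3 h4
  have hmem : T c * S c ∈ initialIsometries a :=
    polar_star_mul_self (star_rangeProj a) (rangeProj_mul_self a) (hTq c) h1 h2 h3
  refine ⟨hmem, ?_⟩
  rintro ⟨w, hw, hc⟩
  have hw' : star w * w = q := hw
  -- `E` is the block-diagonal compression into the commutant of `a`. Writing `T c = w * E (w* v)`
  -- shows that `T c` intertwines `a` with `c` and that `T* T` commutes with `a`.
  set E : (H →L[ℂ] H) → (H →L[ℂ] H) := fun y => ∑ i ∈ I, P i * y * P i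
  have hTE : T c = w * E (star w * v) := by
    simp only [T, E, Finset.mul_sum]
    refine Finset.sum_congr rfl fun i hi => ?_
    rw [hc, aeval_conj ha hw (hp0 i hi)]
    simp only [mul_assoc, P]
  have hPa : ∀ i ∈ I, P i * a = i • P i := fun i hi => by
    have : P i * a = a * P i := by simpa using ((Commute.all (p i) Polynomial.X).map (aeval a)).eq
    rw [this, hap i hi]
  have haE : ∀ y, Commute a (E y) := fun y => by
    change a * E y = E y * a
    simp only [E, Finset.mul_sum, Finset.sum_mul]
    refine Finset.sum_congr rfl fun i hi => ?_
    rw [mul_assoc _ _ a, hPa i hi, ← mul_assoc, ← mul_assoc, hap i hi]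
    simp only [smul_mul_assoc, mul_smul_comm, P]
  have hEs : ∀ y, star (E y) = E (star y) := fun y => by
    simp only [E, star_sum, star_mul]
    exact Finset.sum_congr rfl fun i hi => by rw [hstar i hi, mul_assoc]
  have hqE : ∀ y, q * E y = E y := fun y => by
    simp only [E, Finset.mul_sum]
    exact Finset.sum_congr rfl fun i hi => by rw [← mul_assoc, ← mul_assoc, hqP i hi]
  have hTT : star (T c) * T c = E (star (star w * v)) * E (star w * v) := by
    rw [hTE, star_mul, hEs, mul_assoc, ← mul_assoc (star w), hw', hqE]
  have hTa : Commute (star (T c) * T c) a := by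
    rw [hTT]; exact ((haE _).mul_right (haE _)).symm
  have hqa : Commute q a := (rangeProj_mul a).trans (mul_rangeProj ha).symm
  have hSa : Commute (S c) a := polar_commute h1 h2 h3 hTa hqa
  have hcT : c * T c = T c * a := by
    rw [hTE, mul_assoc w, ← (haE _).eq, ← mul_assoc c, ← mul_assoc w, hc, conj_mul_of_mem ha hw]
  have hec : e c = w * star w := by
    calc e c = ∑ i ∈ I, w * P i * star w := Finset.sum_congr rfl fun i hi => by
          rw [hc]; exact aeval_conj ha hw (hp0 i hi)
      _ = w * q * star w := by rw [← hsum, Finset.mul_sum, Finset.sum_mul]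
      _ = _ := by rw [mul_rangeProj_of_mem hw]
  set σ := T c * S c
  have hσσ : star σ * σ = q := hmem
  have hσa : σ * a = c * σ := by
    rw [mul_assoc, hSa.eq, ← mul_assoc, ← hcT, mul_assoc]
  have heσ : w * star w * σ = σ := by
    have : w * star w * T c = T c := by
      rw [hTE, mul_assoc w, ← mul_assoc (star w), hw', hqE]
    rw [← mul_assoc, this]
  have heσ' : star σ * (w * star w) = star σ := by
    simpa [mul_assoc] using congrArg star heσ
  set d := w * star w - σ * star σ
  have hdd : star d * d = d := by
    have hd : star d = d := by simp [d]
    have t1 : w * star w * (w * star w) = w * star w := by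
      rw [mul_assoc, ← mul_assoc (star w), hw', rangeProj_mul_star_of_mem hw]
    have t2 : σ * star σ * (σ * star σ) = σ * star σ := by
      rw [mul_assoc, ← mul_assoc (star σ), hσσ, rangeProj_mul_star_of_mem hmem]
    have t3 : w * star w * (σ * star σ) = σ * star σ := by rw [← mul_assoc, heσ]
    have t4 : σ * star σ * (w * star w) = σ * star σ := by rw [mul_assoc, heσ']
    rw [hd]
    simp only [d, sub_mul, mul_sub, t1, t2, t3, t4]
    abel
  -- The difference `d` is a projection, so its norm satisfies `‖d‖ ^ 2 = ‖d‖ < 1`.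
  have hd0 : d = 0 := by
    rw [hec] at h4
    have hn : ‖d‖ * ‖d‖ = ‖d‖ := by rw [← CStarRing.norm_star_mul_self, hdd]
    by_contra hne
    have : 0 < ‖d‖ := norm_pos_iff.2 hne
    have h4' : ‖d‖ < 1 := h4
    nlinarith
  calc σ * a * star σ = c * (σ * star σ) := by rw [hσa, mul_assoc]
    _ = c * (w * star w) := by rw [sub_eq_zero.1 hd0]
    _ = c := by
        rw [← mul_assoc, hc, conj_mul_of_mem ha hw]

end LocalSection

/-! ### Images of analytic retractions -/

section Retraction

open Filter Topology

/-- A set that is locally the image of an analytic retraction is an embedded split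
submanifold. -/
theorem isEmbeddedSplitSubmanifold_of_retraction {X : Type*} [NormedAddCommGroup X]
    [NormedSpace ℝ X] [CompleteSpace X] {S : Set X}
    (h : ∀ x ∈ S, ∃ r : X → X, ContDiffAt ℝ ω r x ∧
      ∀ᶠ y in 𝓝 x, r y ∈ S ∧ (y ∈ S → r y = y)) : IsEmbeddedSplitSubmanifold S := by
  intro x hx
  obtain ⟨r, hr, hev⟩ := h x hx
  have hrx : r x = x := hev.self_of_nhds.2 hx
  have hω : (ω : WithTop ℕ∞) ≠ 0 := by simp
  have hrd : DifferentiableAt ℝ r x := hr.differentiableAt hω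
  set P : X →L[ℝ] X := fderiv ℝ r x
  have hP : HasFDerivAt r P x := hrd.hasFDerivAt
  have hrev : ∀ᶠ y in 𝓝 x, r y ∈ S ∧ (r (r y) = r y) := by
    have : ∀ᶠ y in 𝓝 x, (r y ∈ S → r (r y) = r y) := by
      refine hrd.continuousAt.eventually (p := fun z => z ∈ S → r z = z) ?_
      rw [hrx]; exact hev.mono fun _ h => h.2
    filter_upwards [hev, this] with y h1 h2 using ⟨h1.1, h2 h1.1⟩
  have hPP : P ∘L P = P := by
    have h1 : HasFDerivAt (r ∘ r) (P ∘L P) x := by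
      refine HasFDerivAt.comp x ?_ hP
      rw [hrx]; exact hP
    exact h1.unique (hP.congr_of_eventuallyEq (hrev.mono fun y hy => hy.2))
  have hPPy : ∀ y, P (P y) = P y := fun y => DFunLike.congr_fun hPP y
  -- The `P`-part records the retracted point and the `(1 - P)`-part the displacement `y - r y`. The
  -- derivative at `x` is `P P + (1 - P) (1 - P) = 1`, and `f` conjugates `r` to `P` near `x`.
  set f : X → X := fun y => P (r y - x) + ((y - r y) - P (y - r y))
  have hf : ContDiffAt ℝ ω f x := by
    have h1 := hr.sub (contDiffAt_const (c := x))
    have h2 := contDiffAt_id.sub hr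
    exact (P.contDiff.contDiffAt.comp x h1).add (h2.sub (P.contDiff.contDiffAt.comp x h2))
  have hf' : HasFDerivAt f (ContinuousLinearEquiv.refl ℝ X : X →L[ℝ] X) x := by
    have h1 : HasFDerivAt (fun y => r y - x) P x := hP.sub_const x
    have h2 : HasFDerivAt (fun y => y - r y) (ContinuousLinearMap.id ℝ X - P) x :=
      (hasFDerivAt_id x).sub hP
    have h3 := (P.hasFDerivAt.comp x h1).add (h2.sub (P.hasFDerivAt.comp x h2))
    have he : ((ContinuousLinearEquiv.refl ℝ X : X ≃L[ℝ] X) : X →L[ℝ] X) =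
        P ∘L P + ((ContinuousLinearMap.id ℝ X - P) - P ∘L (ContinuousLinearMap.id ℝ X - P)) := by
      ext y; simp [hPPy]
    rw [he]
    exact h3
  have hfx : f x = 0 := by simp [f, hrx]
  set φ := hf.toOpenPartialHomeomorph f hf' hω
  have hxφ : x ∈ φ.source := hf.mem_toOpenPartialHomeomorph_source hf' hω
  have hφf : ∀ y, φ y = f y := fun y => rfl
  have hψ : ContDiffAt ℝ ω φ.symm (f x) := hf.to_localInverse hf' hω
  have hfP : ∀ᶠ y in 𝓝 x, P (f y) = f (r y) := by
    filter_upwards [hrev] with y hy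
    simp [f, hy.2, hPPy]
  have hsrc : ∀ᶠ y in 𝓝 x, r y ∈ φ.source := by
    refine hrd.continuousAt.eventually ?_
    rw [hrx]; exact φ.open_source.mem_nhds hxφ
  -- Order `ω` at one point spreads to a neighbourhood, which order `∞` in the sense of `ContDiffAt`
  -- need not do.
  have hψev : ∀ᶠ y in 𝓝 x, ContDiffAt ℝ ω φ.symm (f y) :=
    hf.continuousAt.eventually (hψ.eventually (by simp))
  obtain ⟨O, hO, hOo, hxO⟩ := eventually_nhds_iff.1
    (hev.and (hrev.and (hfP.and (hsrc.and (hψev.and (hf.eventually (by simp)))))))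
  refine ⟨P.range, φ.restrOpen O hOo, ?_, ⟨hxφ, hxO⟩, hfx, ?_, ?_, ?_⟩
  · refine ⟨P.codRestrict _ fun y => ⟨y, rfl⟩, ?_⟩
    rintro ⟨_, y, rfl⟩
    exact Subtype.ext (hPPy y)
  · intro y hy
    exact ((hO y hy.2).2.2.2.2.2.of_le le_top).contDiffWithinAt
  · intro z hz
    have hz' := (φ.restrOpen O hOo).map_target hz
    have h1 := (hO _ hz'.2).2.2.2.2.1
    have h2 : f ((φ.restrOpen O hOo).symm z) = z := (φ.restrOpen O hOo).right_inv hz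
    rw [h2] at h1
    exact (h1.of_le le_top).contDiffWithinAt
  · intro y hy
    obtain ⟨h1, h2, h3, h4, -⟩ := hO y hy.2
    change y ∈ S ↔ f y ∈ P.range
    constructor
    · intro hyS
      rw [show f y = P (r y - x) by simp [f, h1.2 hyS]]
      exact ⟨_, rfl⟩
    -- If `f y` is in the range of `P`, then `f (r y) = P (f y) = f y`, and injectivity of the chart
    -- gives `r y = y`.
    · rintro ⟨u, hu⟩
      have hu' : P u = f y := hu
      have h5 : f (r y) = f y := by rw [← h3, ← hu', hPPy]
      have h6 : r y = y := φ.injOn h4 hy.1 h5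
      rw [← h6]; exact h1.1

end Retraction

/-! ### Conclusions for finite spectrum -/

section Main

open Filter Topology

variable {H : Type*} [NormedAddCommGroup H] [InnerProductSpace ℂ H] [CompleteSpace H]
  {a : H →L[ℂ] H} (ha : IsStarNormal a) (hfin : (spectrum ℂ a).Finite)
include ha hfin

theorem hasSmoothLocalSections_of_finite_spectrum : HasSmoothLocalSections a := by
  intro v hv
  obtain ⟨σ, hσ, hσv, hev⟩ := exists_analytic_section ha hfin hv
  obtain ⟨U, hU, hUo, hvU⟩ := eventually_nhds_iff.1 ((hσ.eventually (by simp)).and hev)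
  exact ⟨U, σ, hUo, hvU, fun c hc => ((hU c hc).1.of_le le_top).contDiffWithinAt, hσv,
    fun c hc => ⟨(hU c hc.1).2.1, (hU c hc.1).2.2 hc.2⟩⟩

theorem isEmbeddedSplitSubmanifold_orbit_of_finite_spectrum :
    IsEmbeddedSplitSubmanifold (orbit a) := by
  refine isEmbeddedSplitSubmanifold_of_retraction ?_
  rintro _ ⟨v, hv, rfl⟩
  obtain ⟨σ, hσ, hσv, hev⟩ := exists_analytic_section ha hfin hv
  refine ⟨fun c => σ c * a * star (σ c), ?_, ?_⟩
  · exact (hσ.mul contDiffAt_const).mul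
      ((starL' ℝ : (H →L[ℂ] H) ≃L[ℝ] (H →L[ℂ] H)).contDiff.contDiffAt.comp _ hσ)
  · filter_upwards [hev] with c hc using ⟨⟨σ c, hc.1, rfl⟩, hc.2⟩

end Main

end GroupoidOrbit

end

theorem mainTheorem12 {H : Type*} [NormedAddCommGroup H] [InnerProductSpace ℂ H]
    [CompleteSpace H] [TopologicalSpace.SeparableSpace H] (hH : ¬ FiniteDimensional ℂ H)
    (a : H →L[ℂ] H) (ha : IsStarNormal a) :
    (IsClosed (GroupoidOrbit.orbit a) →
      GroupoidOrbit.quotientTopology a = GroupoidOrbit.normTopology a →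
        (spectrum ℂ a).Finite ∧
        IsClosed (GroupoidOrbit.orbit a) ∧
        GroupoidOrbit.IsEmbeddedSplitSubmanifold (GroupoidOrbit.orbit a) ∧
        GroupoidOrbit.HasSmoothLocalSections a) ∧
    ((spectrum ℂ a).Infinite →
      (∀ z : ℂ, AccPt z (Filter.principal (spectrum ℂ a)) → z = 0) →
        GroupoidOrbit.quotientTopology a < GroupoidOrbit.normTopology a) := by
  refine ⟨fun hclosed htop => ?_, fun hinf _ =>
    lt_of_le_of_ne (GroupoidOrbit.quotientTopology_le a)
      (GroupoidOrbit.quotientTopology_ne_of_infinite_spectrum ha hinf)⟩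
  have hfin : (spectrum ℂ a).Finite := by
    by_contra hinf
    exact GroupoidOrbit.quotientTopology_ne_of_infinite_spectrum ha hinf htop
  exact ⟨hfin, hclosed, GroupoidOrbit.isEmbeddedSplitSubmanifold_orbit_of_finite_spectrum ha hfin,
    GroupoidOrbit.hasSmoothLocalSections_of_finite_spectrum ha hfin⟩
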